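/- Let $\Omega=\mathbb{T}^d=\mathbb{R}^d/\mathbb{Z}^d$, let $\phi,\psi\in C^1(\Omega)$ with $\phi<\psi$ in $\Omega$, and for $\varepsilon>0$ put $|p|_\varepsilon=\sqrt{\varepsilon^2+|p|^2}$ for $p\in\mathbb{R}^d$ and $V_\varepsilon(s)=V_\varepsilon(x,s)=\frac1\varepsilon(\phi(x)-s)_+^4+\frac1\varepsilon(s-\psi(x))_+^4$, with $V_\varepsilon'=\partial_sV_\varepsilon$. Let $u_\varepsilon\in C^1(\Omega)$ for $\varepsilon\in(0,1)$ and let $u\in W^{1,\infty}(\Omega)$ have weak gradient $\nabla u$. Write $$\nu_\varepsilon=-\frac{\nabla u_\varepsilon}{|\nabla u_\varepsilon|_\varepsilon},\qquad H_\varepsilon=\operatorname{div}\nu_\varepsilon,\qquad f_\varepsilon=-V_\varepsilon'(u_\varepsilon),$$ where the divergence is taken in the sense of distributions and is assumed to be in $L^1(\Omega)$. Assume that (A1) $\sup_{\varepsilon\in(0,1),\,x\in\Omega}\{|u_\varepsilon(x)|,|\nabla u_\varepsilon(x)|\}<\infty$; (A2) $u_\varepsilon\to u$ uniformly in $\Omega$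 as $\varepsilon\to0$, and $\phi\le u\le\psi$ in $\Omega$; (A3) $\nabla u_\varepsilon\rightharpoonup\nabla u$ weakly-$*$ in $L^\infty(\Omega;\mathbb{R}^d)$ as $\varepsilon\to0$; (A4) $\sup_{\varepsilon\in(0,1)}\int_\Omega|-H_\varepsilon+f_\varepsilon|\,dx<\infty$. Then the following hold. (i) If $\varepsilon_i\in(0,1)$, $\varepsilon_i\to0$ and $\nu_{\varepsilon_i}\rightharpoonup\nu$ weakly-$*$ in $L^\infty(\Omega;\mathbb{R}^d)$, then $\nu(x)=-\frac{\nabla u(x)}{|\nabla u(x)|}$ for a.e. $x\in\{\nabla u\neq0\}$. (ii) $\nu_\varepsilon\to-\frac{\nabla u}{|\nabla u|}$ strongly in $L^2(\{\nabla u\ne0\};\mathbb{R}^d)$ as $\varepsilon\to0$. -/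

import Mathlib

open MeasureTheory Filter Topology Set

noncomputable section

namespace ObstacleMCF

/-- Euclidean space `ℝ^d`. Functions on the flat torus `𝕋^d = ℝ^d / ℤ^d` are represented by
`ℤ^d`-periodic functions on `ℝ^d`. -/
abbrev E (d : ℕ) : Type := EuclideanSpace ℝ (Fin d)

/-- `f` has period `1` in every coordinate direction, i.e. it is a function on `𝕋^d`. -/
def IsPeriodic {d : ℕ} {β : Type*} (f : E d → β) : Prop :=
  ∀ (i : Fin d) (x : E d), f (x + EuclideanSpace.single i (1 : ℝ)) = f x

/-- `f ∈ C¹(𝕋^d)`. -/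
def IsC1Torus {d : ℕ} (f : E d → ℝ) : Prop :=
  IsPeriodic f ∧ ContDiff ℝ 1 f

/-- The unit cube `[0,1)^d`, a fundamental domain of the torus. -/
def cube (d : ℕ) : Set (E d) := {x | ∀ i, x i ∈ Ico (0 : ℝ) 1}

/-- Lebesgue measure on the torus, as a measure on the fundamental domain.
Classes of functions modulo null sets (`L^p` functions on the torus) are represented by functions
whose values only matter on the cube. -/
def torusMeasure (d : ℕ) : Measure (E d) := volume.restrict (cube d)

/-- Weak-* convergence in `L^∞(𝕋^d; ℝ^d)`. -/
def WeakStarTendsto {d : ℕ} {ι : Type*} (l : Filter ι) (F : ι → E d → E d) (F₀ : E d → E d) :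
    Prop :=
  (∀ᶠ i in l, MemLp (F i) ⊤ (torusMeasure d)) ∧ MemLp F₀ ⊤ (torusMeasure d) ∧
  ∀ η : E d → E d, Integrable η (torusMeasure d) →
    Tendsto (fun i => ∫ x, inner ℝ (F i x) (η x) ∂(torusMeasure d)) l
      (𝓝 (∫ x, inner ℝ (F₀ x) (η x) ∂(torusMeasure d)))

/-- Strong convergence in `L²(A; ℝ^d)` for a subset `A` of the torus. -/
def StrongL2Tendsto {d : ℕ} {ι : Type*} (A : Set (E d)) (l : Filter ι) (F : ι → E d → E d)
    (F₀ : E d → E d) : Prop :=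
  (∀ᶠ i in l, MemLp (F i) 2 ((torusMeasure d).restrict A)) ∧
  MemLp F₀ 2 ((torusMeasure d).restrict A) ∧
  Tendsto (fun i => eLpNorm (F i - F₀) 2 ((torusMeasure d).restrict A)) l (𝓝 0)

/-- `u ∈ W^{1,∞}(𝕋^d)` with weak gradient `G`. -/
def IsW1InfWithGradient {d : ℕ} (u : E d → ℝ) (G : E d → E d) : Prop :=
  IsPeriodic u ∧ MemLp u ⊤ (torusMeasure d) ∧ MemLp G ⊤ (torusMeasure d) ∧
  ∀ ζ : E d → ℝ, IsC1Torus ζ → ∀ i : Fin d,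
    ∫ x, u x * (gradient ζ x) i ∂(torusMeasure d) = -∫ x, (G x) i * ζ x ∂(torusMeasure d)

/-- `h ∈ L¹(𝕋^d)` is the weak (distributional) divergence of the vector field `F`. -/
def IsWeakDivergence {d : ℕ} (F : E d → E d) (h : E d → ℝ) : Prop :=
  Integrable h (torusMeasure d) ∧
  ∀ ζ : E d → ℝ, IsC1Torus ζ →
    ∫ x, inner ℝ (F x) (gradient ζ x) ∂(torusMeasure d) = -∫ x, h x * ζ x ∂(torusMeasure d)

/-- `|p|_ε = √(ε² + |p|²)`. -/
def normEps {d : ℕ} (ε : ℝ) (p : E d) : ℝ := Real.sqrt (ε ^ 2 + ‖p‖ ^ 2)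

/-- The approximate normal `ν_ε = -∇v / |∇v|_ε`. -/
def approxNormal {d : ℕ} (ε : ℝ) (v : E d → ℝ) (x : E d) : E d :=
  -((normEps ε (gradient v x))⁻¹ • gradient v x)

/-- The penalization `V_ε(s) = (a - s)_+^4 / ε + (s - b)_+^4 / ε` for obstacle values `a`
(below) and `b` (above). -/
def potential (ε a b s : ℝ) : ℝ :=
  1 / ε * (max (a - s) 0) ^ 4 + 1 / ε * (max (s - b) 0) ^ 4

/-- The forcing `f_ε = -V_ε'(v)`, where `'` is the derivative in the variable `s`. -/
def forcing {d : ℕ} (ε : ℝ) (φ ψ v : E d → ℝ) (x : E d) : ℝ :=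
  -deriv (potential ε (φ x) (ψ x)) (v x)

end ObstacleMCF

end

/-!
Testing `H_ε = div ν_ε` with `u_ε - u` gives
`∫ ⟨ν_ε, ∇u⟩ = ∫ ⟨ν_ε, ∇u_ε⟩ + ∫ H_ε (u_ε - u)`. The force `f_ε` pushes `u_ε` towards the region
between the obstacles, so `f_ε (u_ε - u) ≤ 0` and the last integral is at most
`‖-H_ε + f_ε‖_{L¹} ‖u_ε - u‖_∞ → 0`; the first one on the right is `-∫ |∇u_ε|` up to `O(ε)`. Since
the `L¹` norm is weakly lower semicontinuous, the nonnegative defect `∫ (|∇u| + ⟨ν_ε, ∇u⟩)` tends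
to zero. Finally `|p| |ν + p / |p||² ≤ 2 (|p| + ⟨ν, p⟩)` for `|ν| ≤ 1`, so a vanishing defect forces
`ν_ε → -∇u / |∇u|` strongly where `∇u ≠ 0`, and weak-* limits of `ν_ε` must agree with this strong
limit.
-/

namespace ObstacleMCF

section UnitVectors

lemma norm_normalize_le_one {F : Type*} [NormedAddCommGroup F] [NormedSpace ℝ F] (p : F) :
    ‖NormedSpace.normalize p‖ ≤ 1 := by
  rw [NormedSpace.normalize, norm_smul, norm_inv, norm_norm]
  exact inv_mul_le_one

variable {F : Type*} [NormedAddCommGroup F] [InnerProductSpace ℝ F]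

lemma inner_normalize_self (p : F) : inner ℝ p (NormedSpace.normalize p) = ‖p‖ := by
  calc inner ℝ p (NormedSpace.normalize p) = ‖p‖⁻¹ * (‖p‖ * ‖p‖) := by
        rw [NormedSpace.normalize, real_inner_smul_right, real_inner_self_eq_norm_mul_norm]
    _ = ‖p‖ := by rw [← mul_assoc, inv_mul_mul_self]

lemma norm_mul_sq_norm_add_normalize_le {ν : F} (hν : ‖ν‖ ≤ 1) (p : F) :
    ‖p‖ * ‖ν + NormedSpace.normalize p‖ ^ 2 ≤ 2 * (‖p‖ + inner ℝ ν p) := by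
  have hinner : ‖p‖ * inner ℝ ν (NormedSpace.normalize p) = inner ℝ ν p := by
    rw [← real_inner_smul_right, NormedSpace.norm_smul_normalize]
  calc ‖p‖ * ‖ν + NormedSpace.normalize p‖ ^ 2
      = ‖p‖ * (‖ν‖ ^ 2 + ‖NormedSpace.normalize p‖ ^ 2) + 2 * inner ℝ ν p := by
        rw [norm_add_sq_real, ← hinner]
        ring
    _ ≤ ‖p‖ * (1 ^ 2 + 1 ^ 2) + 2 * inner ℝ ν p := by
        gcongr
        exact norm_normalize_le_one p
    _ = 2 * (‖p‖ + inner ℝ ν p) := by ring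

lemma norm_add_inner_nonneg {ν : F} (hν : ‖ν‖ ≤ 1) (p : F) : 0 ≤ ‖p‖ + inner ℝ ν p := by
  have h : 0 ≤ ‖p‖ * ‖ν + NormedSpace.normalize p‖ ^ 2 := by positivity
  linarith [norm_mul_sq_norm_add_normalize_le hν p]

end UnitVectors

section Integration

variable {α F ι : Type*} [MeasurableSpace α] {μ : Measure α}
  [NormedAddCommGroup F] {l : Filter ι}

lemma aestronglyMeasurable_normalize [NormedSpace ℝ F] {f : α → F}
    (hf : AEStronglyMeasurable f μ) :
    AEStronglyMeasurable (fun x => NormedSpace.normalize (f x)) μ :=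
  hf.norm.aemeasurable.inv.aestronglyMeasurable.smul hf

lemma tendstoInMeasure_zero_of_tendsto_integral_norm {f : ι → α → F}
    (hf : ∀ᶠ i in l, Integrable (f i) μ)
    (hlim : Tendsto (fun i => ∫ x, ‖f i x‖ ∂μ) l (𝓝 0)) : TendstoInMeasure μ f l 0 := by
  rw [tendstoInMeasure_iff_enorm]
  intro δ hδ hδ_top
  have hmarkov : Tendsto (fun i => ENNReal.ofReal (∫ x, ‖f i x‖ ∂μ) / δ) l (𝓝 0) := by
    simpa using ENNReal.Tendsto.div_const (ENNReal.tendsto_ofReal hlim) (Or.inr hδ.ne')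
  refine tendsto_of_tendsto_of_tendsto_of_le_of_le' tendsto_const_nhds hmarkov
    (Eventually.of_forall fun _ => zero_le) ?_
  filter_upwards [hf] with i hi
  rw [ofReal_integral_norm_eq_lintegral_enorm hi]
  simpa using meas_ge_le_lintegral_div hi.1.enorm hδ.ne' hδ_top

lemma tendsto_eLpNorm_zero_of_bounded [IsFiniteMeasure μ] [l.IsCountablyGenerated]
    {p : ENNReal} (hp : p ≠ ⊤) {f : ι → α → F} {C : ℝ}
    (hf : ∀ᶠ i in l, AEStronglyMeasurable (f i) μ) (hC : ∀ᶠ i in l, ∀ᵐ x ∂μ, ‖f i x‖ ≤ C)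
    (hlim : ∀ᵐ x ∂μ, Tendsto (fun i => f i x) l (𝓝 0)) :
    Tendsto (fun i => eLpNorm (f i) p μ) l (𝓝 0) := by
  rcases eq_or_ne p 0 with rfl | hp0
  · simpa using tendsto_const_nhds
  have hpos : 0 < p.toReal := ENNReal.toReal_pos hp0 hp
  have hlintegral : Tendsto (fun i => ∫⁻ x, ‖f i x‖ₑ ^ p.toReal ∂μ) l (𝓝 (∫⁻ _, 0 ∂μ)) := by
    refine tendsto_lintegral_filter_of_dominated_convergence'
      (fun _ => ENNReal.ofReal C ^ p.toReal) ?_ ?_ ?_ ?_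
    · filter_upwards [hf] with i hi using hi.enorm.pow_const _
    · filter_upwards [hC] with i hi
      filter_upwards [hi] with x hx
      gcongr
      rw [← ofReal_norm]
      exact ENNReal.ofReal_le_ofReal hx
    · rw [lintegral_const]
      finiteness
    · filter_upwards [hlim] with x hx
      simpa [ENNReal.zero_rpow_of_pos hpos] using (hx.enorm.ennrpow_const p.toReal)
  simp only [eLpNorm_eq_lintegral_rpow_enorm_toReal hp0 hp]
  simpa [ENNReal.zero_rpow_of_pos (inv_pos.2 hpos)] using
    hlintegral.ennrpow_const (1 / p.toReal)

-- Along subsequences the weighted convergence holds pointwise a.e., where the weight can be divided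
-- out.
lemma tendsto_eLpNorm_restrict_of_tendstoInMeasure_mul [IsFiniteMeasure μ]
    [l.IsCountablyGenerated] {p : ENNReal} (hp : p ≠ ⊤) {w : α → ℝ}
    (hw : AEStronglyMeasurable w μ) {f : ι → α → F} {C : ℝ} {k : ℕ} (hk : k ≠ 0)
    (hf : ∀ᶠ i in l, AEStronglyMeasurable (f i) μ) (hC : ∀ᶠ i in l, ∀ x, ‖f i x‖ ≤ C)
    (hlim : TendstoInMeasure μ (fun i x => w x * ‖f i x‖ ^ k) l 0) :
    Tendsto (fun i => eLpNorm (f i) p (μ.restrict {x | w x ≠ 0})) l (𝓝 0) := by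
  have hA : NullMeasurableSet {x | w x ≠ 0} μ :=
    (hw.nullMeasurableSet_eq_fun aestronglyMeasurable_const).compl
  refine tendsto_of_subseq_tendsto fun ns hns => ?_
  obtain ⟨ms, hms, hae⟩ := (hlim.comp hns).exists_seq_tendsto_ae
  have hsub := hns.comp hms.tendsto_atTop
  refine ⟨ms, tendsto_eLpNorm_zero_of_bounded hp
    ((hsub.eventually hf).mono fun _ h => h.restrict)
    ((hsub.eventually hC).mono fun _ h => ae_of_all _ h) ?_⟩
  filter_upwards [ae_restrict_of_ae hae, ae_restrict_mem₀ hA] with x hx hwx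
  have hpow : Tendsto (fun n => ‖f (ns (ms n)) x‖ ^ k) atTop (𝓝 0) := by
    simpa [inv_mul_cancel_left₀ hwx] using hx.const_mul (w x)⁻¹
  rw [tendsto_zero_iff_norm_tendsto_zero]
  simpa [Real.pow_rpow_inv_natCast (norm_nonneg _) hk, Real.zero_rpow, hk] using
    hpow.rpow_const (p := (k : ℝ)⁻¹) (Or.inr (by positivity))

variable [InnerProductSpace ℝ F]

lemma integrable_inner {p q : ENNReal} [p.HolderTriple q 1] {f g : α → F} (hf : MemLp f p μ)
    (hg : MemLp g q μ) : Integrable (fun x => inner ℝ (f x) (g x)) μ := by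
  refine memLp_one_iff_integrable.1
    (MemLp.of_bilin (p := p) (q := q) (inner ℝ) 1 hf hg (hf.1.inner hg.1) (ae_of_all _ fun x => ?_))
  simpa using nnnorm_inner_le_nnnorm (𝕜 := ℝ) (f x) (g x)

lemma tendsto_integral_inner_of_tendsto_eLpNorm {p q : ENNReal} [p.HolderTriple q 1]
    {f : ι → α → F} {f₀ g : α → F}
    (hf : ∀ᶠ i in l, MemLp (f i) p μ) (hf₀ : MemLp f₀ p μ) (hg : MemLp g q μ)
    (hlim : Tendsto (fun i => eLpNorm (f i - f₀) p μ) l (𝓝 0)) :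
    Tendsto (fun i => ∫ x, inner ℝ (f i x) (g x) ∂μ) l (𝓝 (∫ x, inner ℝ (f₀ x) (g x) ∂μ)) := by
  refine tendsto_integral_of_L1' _ (hf₀.1.inner hg.1)
    (hf.mono fun i hi => integrable_inner hi hg) ?_
  have hbound : Tendsto (fun i => eLpNorm (f i - f₀) p μ * eLpNorm g q μ) l (𝓝 0) := by
    simpa using ENNReal.Tendsto.mul_const hlim (Or.inr hg.2.ne)
  refine tendsto_of_tendsto_of_tendsto_of_le_of_le' tendsto_const_nhds hbound
    (Eventually.of_forall fun _ => zero_le) ?_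
  filter_upwards [hf] with i hi
  calc eLpNorm ((fun x => inner ℝ (f i x) (g x)) - fun x => inner ℝ (f₀ x) (g x)) 1 μ
      = eLpNorm (fun x => inner ℝ ((f i - f₀) x) (g x)) 1 μ := by
        congr 1 with x
        exact (inner_sub_left _ _ _).symm
    _ ≤ (1 : NNReal) * eLpNorm (f i - f₀) p μ * eLpNorm g q μ :=
        eLpNorm_le_eLpNorm_mul_eLpNorm'_of_norm (hi.sub hf₀).1 hg.1 (inner ℝ) 1
          (ae_of_all _ fun x => by simpa using norm_inner_le_norm (𝕜 := ℝ) ((f i - f₀) x) (g x))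
    _ = eLpNorm (f i - f₀) p μ * eLpNorm g q μ := by simp

lemma tendsto_eLpNorm_sub_neg_normalize [IsFiniteMeasure μ] [l.IsCountablyGenerated]
    {p : ENNReal} (hp : p ≠ ⊤) {G : α → F} (hG : Integrable G μ) {ν : ι → α → F}
    (hν : ∀ᶠ i in l, AEStronglyMeasurable (ν i) μ) (hν1 : ∀ᶠ i in l, ∀ x, ‖ν i x‖ ≤ 1)
    (hlim : Tendsto (fun i => ∫ x, (‖G x‖ + inner ℝ (ν i x) (G x)) ∂μ) l (𝓝 0)) :
    Tendsto (fun i => eLpNorm (ν i - fun x => -NormedSpace.normalize (G x)) p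
      (μ.restrict {x | G x ≠ 0})) l (𝓝 0) := by
  have hm : ∀ᶠ i in l, AEStronglyMeasurable (ν i - fun x => -NormedSpace.normalize (G x)) μ :=
    hν.mono fun i hi => hi.sub (aestronglyMeasurable_normalize hG.1).neg
  have hbound : ∀ᶠ i in l, ∀ x, ‖(ν i - fun x => -NormedSpace.normalize (G x)) x‖ ≤ 1 + 1 := by
    filter_upwards [hν1] with i hi x
    simpa using norm_add_le_of_le (hi x) (norm_normalize_le_one (G x))
  have hdefect : ∀ᶠ i in l, ∀ x,
      ‖‖G x‖ * ‖(ν i - fun x => -NormedSpace.normalize (G x)) x‖ ^ 2‖ ≤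
        2 * (‖G x‖ + inner ℝ (ν i x) (G x)) := by
    filter_upwards [hν1] with i hi x
    simpa using norm_mul_sq_norm_add_normalize_le (hi x) (G x)
  have hdefect_int : ∀ᶠ i in l, Integrable (fun x => 2 * (‖G x‖ + inner ℝ (ν i x) (G x))) μ := by
    filter_upwards [hν, hν1] with i hi hi1
    exact (hG.norm.add (integrable_inner (p := ⊤) (q := 1) (MemLp.of_bound hi 1 (ae_of_all _ hi1))
      (memLp_one_iff_integrable.2 hG))).const_mul 2
  have hint : ∀ᶠ i in l, Integrable
      (fun x => ‖G x‖ * ‖(ν i - fun x => -NormedSpace.normalize (G x)) x‖ ^ 2) μ := by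
    filter_upwards [hm, hdefect, hdefect_int] with i him hid hii
    exact hii.mono' (hG.1.norm.mul (him.norm.pow 2)) (ae_of_all _ hid)
  have hmeasure := tendstoInMeasure_zero_of_tendsto_integral_norm hint <| by
    refine squeeze_zero' (Eventually.of_forall fun i => integral_nonneg fun x => norm_nonneg _) ?_
      (by simpa using hlim.const_mul 2)
    filter_upwards [hint, hdefect, hdefect_int] with i hi hid hii
    rw [← integral_const_mul]
    exact integral_mono hi.norm hii hid
  simpa only [norm_ne_zero_iff] using
    tendsto_eLpNorm_restrict_of_tendstoInMeasure_mul hp hG.1.norm two_ne_zero hm hbound hmeasure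

lemma integral_mul_le_of_mul_nonpos {f h w : α → ℝ} {η : ℝ} (hf : Integrable f μ)
    (hh : Integrable h μ) (hw : AEStronglyMeasurable w μ) (hη : ∀ᵐ x ∂μ, |w x| ≤ η)
    (hfw : ∀ᵐ x ∂μ, f x * w x ≤ 0) :
    ∫ x, h x * w x ∂μ ≤ (∫ x, |-h x + f x| ∂μ) * η := by
  rw [← integral_mul_const]
  refine integral_mono_ae (hh.mul_bdd hw hη) ((hh.neg.add hf).abs.mul_const η) ?_
  filter_upwards [hη, hfw] with x hηx hfwx
  calc h x * w x = -((-h x + f x) * w x) + f x * w x := by ring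
    _ ≤ |-h x + f x| * |w x| := by
        rw [← abs_mul]
        linarith [neg_le_abs ((-h x + f x) * w x)]
    _ ≤ |-h x + f x| * η := by gcongr

end Integration

section Torus

variable {d : ℕ}

lemma isBounded_cube (d : ℕ) : Bornology.IsBounded (cube d) := by
  refine (Metric.isBounded_closedBall (x := (0 : E d)) (r := √d)).subset fun x hx => ?_
  rw [mem_closedBall_zero_iff, EuclideanSpace.norm_eq]
  gcongr
  calc ∑ i, ‖x i‖ ^ 2 ≤ ∑ _i : Fin d, (1 : ℝ) := by
        gcongr with i
        exact pow_le_one₀ (norm_nonneg _) (abs_le.2 ⟨by linarith [(hx i).1], (hx i).2.le⟩)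
    _ = d := by simp

instance isFiniteMeasure_torusMeasure (d : ℕ) : IsFiniteMeasure (torusMeasure d) := by
  refine ⟨?_⟩
  rw [torusMeasure, Measure.restrict_apply_univ]
  exact (isBounded_cube d).measure_lt_top

lemma memLp_top_torusMeasure_of_continuous {F : Type*} [NormedAddCommGroup F] {f : E d → F}
    (hf : Continuous f) : MemLp f ⊤ (torusMeasure d) := by
  obtain ⟨C, hC⟩ :=
    (isBounded_cube d).isCompact_closure.exists_bound_of_continuousOn hf.continuousOn
  exact .of_bound hf.aestronglyMeasurable C <|
    ae_restrict_of_ae_restrict_of_subset subset_closure <|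
      ae_restrict_of_forall_mem isClosed_closure.measurableSet hC

lemma integrable_torusMeasure_of_continuous {F : Type*} [NormedAddCommGroup F] {f : E d → F}
    (hf : Continuous f) : Integrable f (torusMeasure d) :=
  (memLp_top_torusMeasure_of_continuous hf).integrable le_top

lemma IsC1Torus.continuous {v : E d → ℝ} (hv : IsC1Torus v) : Continuous v :=
  hv.2.continuous

lemma IsC1Torus.continuous_gradient {v : E d → ℝ} (hv : IsC1Torus v) : Continuous (gradient v) :=
  (InnerProductSpace.toDual ℝ (E d)).symm.continuous.comp (hv.2.continuous_fderiv one_ne_zero)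

end Torus

section WeakConvergence

variable {d : ℕ} {ι : Type*} {l : Filter ι}

lemma StrongL2Tendsto.comp_tendsto {κ : Type*} {k : Filter κ} {A : Set (E d)}
    {F : ι → E d → E d} {F₀ : E d → E d} (h : StrongL2Tendsto A l F F₀) {e : κ → ι}
    (he : Tendsto e k l) : StrongL2Tendsto A k (fun j => F (e j)) F₀ :=
  ⟨he.eventually h.1, h.2.1, h.2.2.comp he⟩

lemma WeakStarTendsto.ae_eq_of_strongL2Tendsto [l.NeBot] {A : Set (E d)}
    (hA : NullMeasurableSet A (torusMeasure d)) {F : ι → E d → E d} {F₁ F₂ : E d → E d}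
    (hweak : WeakStarTendsto l F F₁) (hstrong : StrongL2Tendsto A l F F₂) :
    F₁ =ᵐ[(torusMeasure d).restrict A] F₂ := by
  have hF₁ : MemLp F₁ 2 ((torusMeasure d).restrict A) :=
    (hweak.2.1.restrict A).mono_exponent le_top
  have hdiff : MemLp (F₁ - F₂) 2 ((torusMeasure d).restrict A) := hF₁.sub hstrong.2.1
  have hindicator (K : E d → E d) :
      ∫ x, inner ℝ (K x) (A.indicator (F₁ - F₂) x) ∂torusMeasure d =
        ∫ x in A, inner ℝ (K x) ((F₁ - F₂) x) ∂torusMeasure d := by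
    rw [← integral_indicator₀ hA]
    congr 1 with x
    by_cases hx : x ∈ A <;> simp [hx]
  have hlim₁ := hweak.2.2 (A.indicator (F₁ - F₂))
    (IntegrableOn.integrable_indicator₀ (hdiff.integrable one_le_two) hA)
  simp only [hindicator] at hlim₁
  have hlim₂ :=
    tendsto_integral_inner_of_tendsto_eLpNorm hstrong.1 hstrong.2.1 hdiff hstrong.2.2
  have hzero : ∫ x in A, ‖(F₁ - F₂) x‖ ^ 2 ∂torusMeasure d = 0 := by
    calc ∫ x in A, ‖(F₁ - F₂) x‖ ^ 2 ∂torusMeasure d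
        = ∫ x in A, (inner ℝ (F₁ x) ((F₁ - F₂) x) - inner ℝ (F₂ x) ((F₁ - F₂) x))
            ∂torusMeasure d := by
          congr 1 with x
          rw [← inner_sub_left, ← Pi.sub_apply, real_inner_self_eq_norm_sq]
      _ = 0 := by
          rw [integral_sub (integrable_inner hF₁ hdiff) (integrable_inner hstrong.2.1 hdiff),
            tendsto_nhds_unique hlim₁ hlim₂, sub_self]
  have hae := (integral_eq_zero_iff_of_nonneg (fun x => sq_nonneg ‖(F₁ - F₂) x‖)
    (hdiff.integrable_norm_pow two_ne_zero)).1 hzero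
  filter_upwards [hae] with x hx
  simpa [sub_eq_zero] using hx

lemma WeakStarTendsto.eventually_lt_integral_norm {F : ι → E d → E d} {F₀ : E d → E d}
    (h : WeakStarTendsto l F F₀) {b : ℝ} (hb : b < ∫ x, ‖F₀ x‖ ∂torusMeasure d) :
    ∀ᶠ i in l, b < ∫ x, ‖F i x‖ ∂torusMeasure d := by
  have hn : MemLp (fun x => NormedSpace.normalize (F₀ x)) 1 (torusMeasure d) :=
    .of_bound (aestronglyMeasurable_normalize h.2.1.1) 1
      (ae_of_all _ fun x => norm_normalize_le_one (F₀ x))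
  have hlim := h.2.2 _ (memLp_one_iff_integrable.1 hn)
  simp only [inner_normalize_self] at hlim
  filter_upwards [hlim.eventually_const_lt hb, h.1] with i hi hFi
  refine hi.trans_le (integral_mono (integrable_inner hFi hn) (hFi.integrable le_top).norm
    fun x => ?_)
  exact (real_inner_le_norm _ _).trans
    (mul_le_of_le_one_right (norm_nonneg _) (norm_normalize_le_one _))

lemma IsWeakDivergence.integral_inner_eq_of_tendstoUniformly [l.NeBot] [l.IsCountablyGenerated]
    {F : E d → E d} {h : E d → ℝ} (hF : IsWeakDivergence F h)
    (hFint : Integrable F (torusMeasure d)) {w : ι → E d → ℝ}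
    (hw : ∀ᶠ i in l, IsC1Torus (w i)) {u : E d → ℝ} (hwu : TendstoUniformly w u l) {G : E d → E d}
    (hG : WeakStarTendsto l (fun i => gradient (w i)) G) :
    ∫ x, inner ℝ (F x) (G x) ∂torusMeasure d = -∫ x, h x * u x ∂torusMeasure d := by
  have hu : Continuous u := hwu.continuous (hw.mono fun i hi => hi.continuous).frequently
  have hleft := hG.2.2 F hFint
  simp only [real_inner_comm (F _)] at hleft
  have hright : Tendsto (fun i => -∫ x, h x * w i x ∂torusMeasure d) l
      (𝓝 (-∫ x, h x * u x ∂torusMeasure d)) := by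
    refine (tendsto_integral_filter_of_dominated_convergence (fun x => ‖h x‖ * (‖u x‖ + 1))
      ?_ ?_ ?_ ?_).neg
    · filter_upwards [hw] with i hi
      exact hF.1.1.mul hi.continuous.aestronglyMeasurable
    · filter_upwards [Metric.tendstoUniformly_iff.1 hwu 1 one_pos] with i hi
      refine ae_of_all _ fun x => ?_
      rw [norm_mul]
      gcongr
      linarith [norm_sub_norm_le (w i x) (u x), hi x, dist_eq_norm' (u x) (w i x)]
    · exact hF.1.norm.mul_of_top_left
        (memLp_top_torusMeasure_of_continuous (hu.norm.add continuous_const))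
    · exact ae_of_all _ fun x => (hwu.tendsto_at x).const_mul _
  refine tendsto_nhds_unique_of_eventuallyEq hleft hright ?_
  filter_upwards [hw] with i hi using hF.2 _ hi

end WeakConvergence

section ApproxNormal

variable {d : ℕ} {ε : ℝ}

lemma normEps_pos (hε : 0 < ε) (p : E d) : 0 < normEps ε p :=
  Real.sqrt_pos.2 (by positivity)

lemma norm_le_normEps (ε : ℝ) (p : E d) : ‖p‖ ≤ normEps ε p :=
  Real.le_sqrt_of_sq_le (le_add_of_nonneg_left (sq_nonneg ε))

lemma le_normEps (ε : ℝ) (p : E d) : ε ≤ normEps ε p :=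
  Real.le_sqrt_of_sq_le (le_add_of_nonneg_right (sq_nonneg ‖p‖))

lemma norm_approxNormal_le_one (hε : 0 < ε) (v : E d → ℝ) (x : E d) :
    ‖approxNormal ε v x‖ ≤ 1 := by
  have hpos := normEps_pos hε (gradient v x)
  rw [approxNormal, norm_neg, norm_smul, norm_inv, Real.norm_of_nonneg hpos.le,
    inv_mul_le_one₀ hpos]
  exact norm_le_normEps ε _

lemma norm_gradient_le_neg_inner_approxNormal_add (hε : 0 < ε) (v : E d → ℝ) (x : E d) :
    ‖gradient v x‖ ≤ -inner ℝ (approxNormal ε v x) (gradient v x) + ε := by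
  set p := gradient v x
  have hpos := normEps_pos hε p
  have hsq : normEps ε p ^ 2 = ε ^ 2 + ‖p‖ ^ 2 := Real.sq_sqrt (by positivity)
  have hinner : -inner ℝ (approxNormal ε v x) p = normEps ε p - ε * (ε / normEps ε p) := by
    rw [show approxNormal ε v x = -((normEps ε p)⁻¹ • p) from rfl, inner_neg_left, neg_neg,
      real_inner_smul_left, real_inner_self_eq_norm_sq, ← sub_eq_iff_eq_add'.2 hsq]
    field_simp
  have hquot : ε * (ε / normEps ε p) ≤ ε :=
    mul_le_of_le_one_right hε.le ((div_le_one hpos).2 (le_normEps ε p))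
  linarith [norm_le_normEps ε p]

lemma IsC1Torus.continuous_approxNormal (hε : 0 < ε) {v : E d → ℝ} (hv : IsC1Torus v) :
    Continuous (approxNormal ε v) := by
  have hnorm : Continuous fun x => normEps ε (gradient v x) :=
    (continuous_const.add (hv.continuous_gradient.norm.pow 2)).sqrt
  exact ((hnorm.inv₀ fun x => (normEps_pos hε _).ne').smul hv.continuous_gradient).neg

lemma IsC1Torus.integral_norm_gradient_le (hε : 0 < ε) {v : E d → ℝ} (hv : IsC1Torus v) :
    ∫ x, ‖gradient v x‖ ∂torusMeasure d ≤
      -(∫ x, inner ℝ (approxNormal ε v x) (gradient v x) ∂torusMeasure d) +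
        ε * (torusMeasure d).real univ := by
  have hgrad := hv.continuous_gradient
  have hint : Integrable (fun x => -inner ℝ (approxNormal ε v x) (gradient v x))
      (torusMeasure d) :=
    integrable_torusMeasure_of_continuous ((hv.continuous_approxNormal hε).inner hgrad).neg
  calc ∫ x, ‖gradient v x‖ ∂torusMeasure d
      ≤ ∫ x, (-inner ℝ (approxNormal ε v x) (gradient v x) + ε) ∂torusMeasure d :=
        integral_mono (integrable_torusMeasure_of_continuous hgrad.norm)
          (hint.add (integrable_const ε)) (norm_gradient_le_neg_inner_approxNormal_add hε v)
    _ = _ := by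
        rw [integral_add hint (integrable_const ε), integral_neg, integral_const, smul_eq_mul,
          mul_comm ε]

lemma integral_norm_add_inner_approxNormal_le (hε : 0 < ε) {v : E d → ℝ} (hv : IsC1Torus v)
    {H : E d → ℝ} (hH : IsWeakDivergence (approxNormal ε v) H) {u : E d → ℝ} (hu : Continuous u)
    {Du : E d → E d} (hDu : Integrable Du (torusMeasure d))
    (hHu : ∫ x, inner ℝ (approxNormal ε v x) (Du x) ∂torusMeasure d =
      -∫ x, H x * u x ∂torusMeasure d)
    {f : E d → ℝ} (hf : Integrable f (torusMeasure d))
    (hfvu : ∀ᵐ x ∂torusMeasure d, f x * (v x - u x) ≤ 0) {η : ℝ} (hη : ∀ x, |v x - u x| ≤ η) :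
    ∫ x, (‖Du x‖ + inner ℝ (approxNormal ε v x) (Du x)) ∂torusMeasure d ≤
      (∫ x, ‖Du x‖ ∂torusMeasure d) - (∫ x, ‖gradient v x‖ ∂torusMeasure d) +
        ε * (torusMeasure d).real univ + (∫ x, |-H x + f x| ∂torusMeasure d) * η := by
  have hinner : Integrable (fun x => inner ℝ (approxNormal ε v x) (Du x)) (torusMeasure d) :=
    integrable_inner (memLp_top_torusMeasure_of_continuous (hv.continuous_approxNormal hε))
      (memLp_one_iff_integrable.2 hDu)
  have hforce : ∫ x, H x * (v x - u x) ∂torusMeasure d ≤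
      (∫ x, |-H x + f x| ∂torusMeasure d) * η :=
    integral_mul_le_of_mul_nonpos hf hH.1 (hv.continuous.sub hu).aestronglyMeasurable
      (ae_of_all _ hη) hfvu
  have hsplit : ∫ x, H x * (v x - u x) ∂torusMeasure d =
      (∫ x, H x * v x ∂torusMeasure d) - ∫ x, H x * u x ∂torusMeasure d := by
    simp only [mul_sub]
    exact integral_sub (hH.1.mul_of_top_left (memLp_top_torusMeasure_of_continuous hv.continuous))
      (hH.1.mul_of_top_left (memLp_top_torusMeasure_of_continuous hu))
  rw [integral_add hDu.norm hinner]
  linarith [hv.integral_norm_gradient_le hε, hH.2 v hv]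

lemma tendsto_integral_norm_add_inner_approxNormal {ι : Type*} {l : Filter ι} [l.NeBot]
    [l.IsCountablyGenerated] {ε : ι → ℝ} (hε : ∀ᶠ i in l, 0 < ε i) (hε0 : Tendsto ε l (𝓝 0))
    {v : ι → E d → ℝ} (hv : ∀ᶠ i in l, IsC1Torus (v i)) {u : E d → ℝ}
    (hvu : TendstoUniformly v u l) {Du : E d → E d}
    (hDu : WeakStarTendsto l (fun i => gradient (v i)) Du) {H f : ι → E d → ℝ}
    (hH : ∀ᶠ i in l, IsWeakDivergence (approxNormal (ε i) (v i)) (H i))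
    (hf : ∀ᶠ i in l, Integrable (f i) (torusMeasure d))
    (hfvu : ∀ᶠ i in l, ∀ᵐ x ∂torusMeasure d, f i x * (v i x - u x) ≤ 0) {K : ℝ}
    (hK : ∀ᶠ i in l, ∫ x, |-H i x + f i x| ∂torusMeasure d ≤ K) :
    Tendsto (fun i => ∫ x, (‖Du x‖ + inner ℝ (approxNormal (ε i) (v i) x) (Du x)) ∂torusMeasure d)
      l (𝓝 0) := by
  have hu : Continuous u := hvu.continuous (hv.mono fun i hi => hi.continuous).frequently
  have hεm : Tendsto (fun i => ε i * (torusMeasure d).real univ) l (𝓝 0) := by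
    simpa using hε0.mul_const ((torusMeasure d).real univ)
  refine tendsto_order.2 ⟨fun b hb => ?_, fun b hb => ?_⟩
  · filter_upwards [hε] with i hi
    exact hb.trans_le (integral_nonneg fun x =>
      norm_add_inner_nonneg (norm_approxNormal_le_one hi (v i) x) (Du x))
  obtain ⟨η, hη, hKη⟩ := exists_pos_mul_lt (show 0 < b / 3 by positivity) K
  filter_upwards [hε, hv, hH, hf, hfvu, hK, Metric.tendstoUniformly_iff.1 hvu η hη,
    hεm.eventually_lt_const (show 0 < b / 3 by positivity),
    hDu.eventually_lt_integral_norm (sub_lt_self _ (show 0 < b / 3 by positivity))]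
    with i hεi hvi hHi hfi hfvui hKi hdist hεmi hnorm
  have hHu := hHi.integral_inner_eq_of_tendstoUniformly
    (integrable_torusMeasure_of_continuous (hvi.continuous_approxNormal hεi)) hv hvu hDu
  have hbound := integral_norm_add_inner_approxNormal_le hεi hvi hHi hu
    (hDu.2.1.integrable le_top) hHu hfi hfvui
    (fun x => by simpa [Real.dist_eq, abs_sub_comm] using (hdist x).le)
  linarith [mul_le_mul_of_nonneg_right hKi hη.le]

lemma strongL2Tendsto_approxNormal {ι : Type*} {l : Filter ι} [l.IsCountablyGenerated]
    {ε : ι → ℝ} (hε : ∀ᶠ i in l, 0 < ε i) {v : ι → E d → ℝ} (hv : ∀ᶠ i in l, IsC1Torus (v i))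
    {G : E d → E d} (hG : Integrable G (torusMeasure d))
    (hlim : Tendsto
      (fun i => ∫ x, (‖G x‖ + inner ℝ (approxNormal (ε i) (v i) x) (G x)) ∂torusMeasure d)
      l (𝓝 0)) :
    StrongL2Tendsto {x | G x ≠ 0} l (fun i => approxNormal (ε i) (v i))
      (fun x => -NormedSpace.normalize (G x)) := by
  have hν : ∀ᶠ i in l, Continuous (approxNormal (ε i) (v i)) := by
    filter_upwards [hε, hv] with i hεi hvi using hvi.continuous_approxNormal hεi
  refine ⟨?_, ?_, ?_⟩
  · filter_upwards [hν] with i hi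
    exact ((memLp_top_torusMeasure_of_continuous hi).restrict _).mono_exponent le_top
  · exact .of_bound (aestronglyMeasurable_normalize hG.1).neg.restrict 1
      (ae_of_all _ fun x => (norm_neg _).trans_le (norm_normalize_le_one (G x)))
  · exact tendsto_eLpNorm_sub_neg_normalize ENNReal.ofNat_ne_top hG
      (hν.mono fun i hi => hi.aestronglyMeasurable)
      (hε.mono fun i hi => norm_approxNormal_le_one hi (v i)) hlim

end ApproxNormal

section Penalization

variable {d : ℕ}

lemma hasDerivAt_max_zero_pow {n : ℕ} (hn : 1 < n) (t : ℝ) :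
    HasDerivAt (fun s : ℝ => max s 0 ^ n) (n * max t 0 ^ (n - 1)) t := by
  rcases lt_trichotomy t 0 with ht | rfl | ht
  · rw [max_eq_right ht.le, zero_pow (by lia), mul_zero]
    refine (hasDerivAt_const t (0 : ℝ)).congr_of_eventuallyEq ?_
    filter_upwards [gt_mem_nhds ht] with s hs
    rw [max_eq_right hs.le, zero_pow (by lia)]
  · have hle (s : ℝ) : ‖max s 0 ^ n‖ ≤ ‖s ^ n‖ := by
      rw [norm_pow, norm_pow, Real.norm_of_nonneg (le_max_right s 0)]
      gcongr
      exact max_le (le_abs_self s) (norm_nonneg s)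
    rw [max_self, zero_pow (by lia), mul_zero, hasDerivAt_iff_isLittleO_nhds_zero]
    simpa [zero_pow (show n ≠ 0 by lia)] using
      (Asymptotics.isBigO_of_le _ hle).trans_isLittleO (Asymptotics.isLittleO_pow_id hn)
  · rw [max_eq_left ht.le]
    refine (hasDerivAt_pow n t).congr_of_eventuallyEq ?_
    filter_upwards [lt_mem_nhds ht] with s hs
    rw [max_eq_left hs.le]

lemma forcing_eq (ε : ℝ) (φ ψ v : E d → ℝ) (x : E d) :
    forcing ε φ ψ v x =
      4 / ε * max (φ x - v x) 0 ^ 3 - 4 / ε * max (v x - ψ x) 0 ^ 3 := by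
  have hlower := (hasDerivAt_max_zero_pow (n := 4) (by norm_num) (φ x - v x)).comp (v x)
    ((hasDerivAt_id (v x)).const_sub (φ x))
  have hupper := (hasDerivAt_max_zero_pow (n := 4) (by norm_num) (v x - ψ x)).comp (v x)
    ((hasDerivAt_id (v x)).sub_const (ψ x))
  have hpotential : HasDerivAt (potential ε (φ x) (ψ x)) _ (v x) :=
    (hlower.const_mul (1 / ε)).add (hupper.const_mul (1 / ε))
  rw [forcing, hpotential.deriv]
  push_cast
  ring

lemma continuous_forcing (ε : ℝ) {φ ψ v : E d → ℝ} (hφ : Continuous φ) (hψ : Continuous ψ)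
    (hv : Continuous v) : Continuous (forcing ε φ ψ v) := by
  simp only [funext (forcing_eq ε φ ψ v)]
  fun_prop

lemma forcing_mul_sub_nonpos {ε : ℝ} (hε : 0 < ε) {φ ψ u v : E d → ℝ} {x : E d}
    (hφu : φ x ≤ u x) (huψ : u x ≤ ψ x) : forcing ε φ ψ v x * (v x - u x) ≤ 0 := by
  have hlower : max (φ x - v x) 0 ^ 3 * (v x - u x) ≤ 0 := by
    rcases le_total (φ x) (v x) with h | h
    · simp [max_eq_right (sub_nonpos.2 h)]
    · exact mul_nonpos_of_nonneg_of_nonpos (by positivity) (by linarith)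
  have hupper : 0 ≤ max (v x - ψ x) 0 ^ 3 * (v x - u x) := by
    rcases le_total (v x) (ψ x) with h | h
    · simp [max_eq_right (sub_nonpos.2 h)]
    · exact mul_nonneg (by positivity) (by linarith)
  calc forcing ε φ ψ v x * (v x - u x)
      = 4 / ε * (max (φ x - v x) 0 ^ 3 * (v x - u x) - max (v x - ψ x) 0 ^ 3 * (v x - u x)) := by
        rw [forcing_eq]
        ring
    _ ≤ 0 := mul_nonpos_of_nonneg_of_nonpos (by positivity) (by linarith)

end Penalization

end ObstacleMCF

open ObstacleMCF in
theorem mainTheorem11_general {d : ℕ} {uε : ℝ → E d → ℝ}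
    (huε : ∀ ε ∈ Ioo (0 : ℝ) 1, IsC1Torus (uε ε)) {u : E d → ℝ} {Du : E d → E d}
    (hunif : TendstoUniformly uε u (𝓝[>] (0 : ℝ)))
    (hweak : WeakStarTendsto (𝓝[>] (0 : ℝ)) (fun ε => gradient (uε ε)) Du)
    {H : ℝ → E d → ℝ} (hH : ∀ ε ∈ Ioo (0 : ℝ) 1, IsWeakDivergence (approxNormal ε (uε ε)) (H ε))
    {f : ℝ → E d → ℝ} (hf : ∀ ε ∈ Ioo (0 : ℝ) 1, Integrable (f ε) (torusMeasure d))
    (hfu : ∀ ε ∈ Ioo (0 : ℝ) 1, ∀ᵐ x ∂torusMeasure d, f ε x * (uε ε x - u x) ≤ 0)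
    (hbound : ∃ C : ℝ, ∀ ε ∈ Ioo (0 : ℝ) 1, ∫ x, |-H ε x + f ε x| ∂torusMeasure d ≤ C) :
    (∀ e : ℕ → ℝ, (∀ i, e i ∈ Ioo (0 : ℝ) 1) → Tendsto e atTop (𝓝 0) → ∀ ν : E d → E d,
      WeakStarTendsto atTop (fun i => approxNormal (e i) (uε (e i))) ν →
      ∀ᵐ x ∂torusMeasure d, Du x ≠ 0 → ν x = -(‖Du x‖⁻¹ • Du x)) ∧
    StrongL2Tendsto {x | Du x ≠ 0} (𝓝[>] (0 : ℝ)) (fun ε => approxNormal ε (uε ε))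
      (fun x => -(‖Du x‖⁻¹ • Du x)) := by
  obtain ⟨K, hK⟩ := hbound
  have hIoo : ∀ᶠ ε in 𝓝[>] (0 : ℝ), ε ∈ Ioo (0 : ℝ) 1 := Ioo_mem_nhdsGT one_pos
  have hDu : Integrable Du (torusMeasure d) := hweak.2.1.integrable le_top
  have hA : NullMeasurableSet {x | Du x ≠ 0} (torusMeasure d) :=
    (hDu.1.nullMeasurableSet_eq_fun aestronglyMeasurable_const).compl
  have hstrong := strongL2Tendsto_approxNormal (hIoo.mono fun ε hε => hε.1) (hIoo.mono huε) hDu <|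
    tendsto_integral_norm_add_inner_approxNormal (hIoo.mono fun ε hε => hε.1) nhdsWithin_le_nhds
      (hIoo.mono huε) hunif hweak (hIoo.mono hH) (hIoo.mono hf) (hIoo.mono hfu) (hIoo.mono hK)
  refine ⟨fun e he he0 ν hν => (ae_restrict_iff'₀ hA).1 ?_, hstrong⟩
  exact hν.ae_eq_of_strongL2Tendsto hA <| hstrong.comp_tendsto <|
    tendsto_nhdsWithin_iff.2 ⟨he0, .of_forall fun i => (he i).1⟩

theorem mainTheorem11 {d : ℕ}
    -- the obstacles
    (φ ψ : ObstacleMCF.E d → ℝ)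
    (hφ : ObstacleMCF.IsC1Torus φ) (hψ : ObstacleMCF.IsC1Torus ψ)
    (hφψ : ∀ x, φ x < ψ x)
    -- the family `u_ε ∈ C¹`, `0 < ε < 1`, and `u ∈ W^{1,∞}` with weak gradient `Du`
    (uε : ℝ → ObstacleMCF.E d → ℝ)
    (huε : ∀ ε ∈ Set.Ioo (0 : ℝ) 1, ObstacleMCF.IsC1Torus (uε ε))
    (u : ObstacleMCF.E d → ℝ) (Du : ObstacleMCF.E d → ObstacleMCF.E d)
    (hu : ObstacleMCF.IsW1InfWithGradient u Du)
    -- (A1)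
    (hA1 : ∃ C : ℝ, ∀ ε ∈ Set.Ioo (0 : ℝ) 1, ∀ x,
      |uε ε x| ≤ C ∧ ‖gradient (uε ε) x‖ ≤ C)
    -- (A2)
    (hA2 : TendstoUniformly uε u (𝓝[>] (0 : ℝ)))
    (hA2' : ∀ x, φ x ≤ u x ∧ u x ≤ ψ x)
    -- (A3)
    (hA3 : ObstacleMCF.WeakStarTendsto (𝓝[>] (0 : ℝ)) (fun ε => gradient (uε ε)) Du)
    -- (A4), with `H_ε = div ν_ε`
    (H : ℝ → ObstacleMCF.E d → ℝ)
    (hH : ∀ ε ∈ Set.Ioo (0 : ℝ) 1,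
      ObstacleMCF.IsWeakDivergence (ObstacleMCF.approxNormal ε (uε ε)) (H ε))
    (hA4 : ∃ C : ℝ, ∀ ε ∈ Set.Ioo (0 : ℝ) 1,
      ∫ x, |-H ε x + ObstacleMCF.forcing ε φ ψ (uε ε) x| ∂(ObstacleMCF.torusMeasure d) ≤ C) :
    -- (i) every weak-* limit along a sequence `ε_i → 0`
    (∀ (e : ℕ → ℝ), (∀ i, e i ∈ Set.Ioo (0 : ℝ) 1) → Tendsto e atTop (𝓝 0) →
      ∀ ν : ObstacleMCF.E d → ObstacleMCF.E d,
        ObstacleMCF.WeakStarTendsto atTop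
          (fun i => ObstacleMCF.approxNormal (e i) (uε (e i))) ν →
        ∀ᵐ x ∂(ObstacleMCF.torusMeasure d), Du x ≠ 0 → ν x = -(‖Du x‖⁻¹ • Du x)) ∧
    -- (ii) strong convergence of the whole family
    ObstacleMCF.StrongL2Tendsto {x | Du x ≠ 0} (𝓝[>] (0 : ℝ))
      (fun ε => ObstacleMCF.approxNormal ε (uε ε)) (fun x => -(‖Du x‖⁻¹ • Du x)) := by
  open ObstacleMCF in
  exact mainTheorem11_general huε hA2 hA3 hH
    (fun ε hε => integrable_torusMeasure_of_continuous
      (continuous_forcing ε hφ.continuous hψ.continuous (huε ε hε).continuous))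
    (fun ε hε => ae_of_all _ fun x => forcing_mul_sub_nonpos hε.1 (hA2' x).1 (hA2' x).2) hA4
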